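/- Fix a universal machine $U$, with respect to which conditional Kolmogorov complexity $C(x\mid y)$ is defined, and a universal machine $R$, in whose language local routing functions are stored (here a machine maps a binary program and an input to at most one output, and it is universal if it is partial recursive and can simulate every partial recursive machine $V$, translating each program of $V$ into one that is longer by at most a constant depending only on $V$; $U=R$ is allowed). Write $\log$ for the binary logarithm. For a graph $G$ with node set $\{1,\dots,n\}$ let $E(G)\in\{0,1\}^{n(n-1)/2}$ be the string that lists, in lexicographic order of the pairs $u<v$, whether $\{u,v\}$ is an edge. $G$ is $\delta$-random if $C(E(G)\mid n,a)\ge n(n-1)/2-\delta$, where $a$ is the description of $\delta$ and of the family of all labelled graphs that is supplied along with $n$. Routing takes place in the model in which nodes know their neighbours: node $u$ knows for free its own label and the labels of its neighbours, each incident edge carries the label of the neighbour it leads to, and nodes are not relabelled. Node $u$ stores a binary string $F(u)$, a program for $R$; given the label of $u$, the list of labels of its neighbours and the label of a destination $v\ne u$, it has to output the label of the neighbour of $u$ to which a message for $v$ is forwarded. The cost at $u$ is the length $|F(u)|$. The scheme $F$ has stretch at most $s$ if for all $u\neq v$ the route it produces from $u$ reaches $v$ after at most $s\cdot d_G(u,v)$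 edges. **Theorem.** Let $c\ge 0$ be a real constant. There is $n_0$ (depending only on $c$, $U$, $R$) such that for every $n\ge n_0$, every description $a$, and every $c\log n$-random graph $G$ on $\{1,\dots,n\}$, there are a routing scheme $F$ and a set $B$ of nodes (the routing centres) with the following properties. 1. $F$ has stretch at most $1.5$. 2. $|B|\le 1+(c+3)\log n$. 3. $|F(u)|\le\lceil\log(n+1)\rceil$ for every node $u\notin B$. 4. $|F(u)|\le 3n$ for every node $u\in B$. 5. The complete routing scheme takes $\sum_u|F(u)|<(3c+20)\,n\log n$ bits. -/

import Mathlib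

namespace CompactRouting

/-! ### Machines and conditional Kolmogorov complexity

Finite objects (strings, numbers, tuples, lists) are identified with natural numbers through
the standard computable codings `Encodable.encode`. -/

/-- A machine takes a binary program and an input and may halt with an output. -/
abbrev Machine : Type := List Bool → ℕ →. ℕ

/-- A universal machine: it is partial recursive, and it simulates every partial recursive
machine `V`, every program of `V` being translated into one that is at most a constant
(depending on `V` only) longer and that computes the same partial function of the input. -/
def Machine.IsUniversal (U : Machine) : Prop :=
  Partrec₂ U ∧
    ∀ V : Machine, Partrec₂ V →
      ∃ k : ℕ, ∀ p : List Bool, ∃ q : List Bool,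
        q.length ≤ p.length + k ∧ ∀ y : ℕ, U q y = V p y

/-- `C_U(x | y)`: the length of a shortest program from which `U` computes `x` given `y`.
For a universal `U` such a program exists for all `x` and `y`. -/
noncomputable def condComplexity (U : Machine) (x y : ℕ) : ℕ :=
  sInf {l : ℕ | ∃ p : List Bool, p.length = l ∧ x ∈ U p y}

/-- Splits the string `1^i 0 q` into `(i, q)`. -/
def splitIndex (p : List Bool) : ℕ × List Bool :=
  List.rec (0, []) (fun b l r => bif b then (r.1 + 1, r.2) else (0, l)) p

/-- A concrete machine: on the program `1^i 0 q` and the input `y` it runs the `i`-th partial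
recursive function on the pair `(q, y)`. -/
def referenceMachine : Machine := fun p y =>
  (Denumerable.ofNat Nat.Partrec.Code (splitIndex p).1).eval
    (Encodable.encode ((splitIndex p).2, y))

theorem splitIndex_append (i : ℕ) (q : List Bool) :
    splitIndex (List.replicate i true ++ false :: q) = (i, q) := by
  induction i with
  | zero => rfl
  | succ i ih =>
    rw [List.replicate_succ, List.cons_append]
    change ((splitIndex (List.replicate i true ++ false :: q)).1 + 1,
      (splitIndex (List.replicate i true ++ false :: q)).2) = (i + 1, q)
    rw [ih]

theorem computable_splitIndex : Computable splitIndex := by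
  apply Primrec.to_comp
  have h : Primrec₂ fun (_ : List Bool) (x : Bool × List Bool × (ℕ × List Bool)) =>
      bif x.1 then (x.2.2.1 + 1, x.2.2.2) else (0, x.2.1) := by
    refine Primrec.cond (Primrec.fst.comp Primrec.snd) (Primrec.pair ?_ ?_) (Primrec.pair ?_ ?_)
    · exact Primrec.succ.comp (Primrec.fst.comp (Primrec.snd.comp (Primrec.snd.comp Primrec.snd)))
    · exact Primrec.snd.comp (Primrec.snd.comp (Primrec.snd.comp Primrec.snd))
    · exact Primrec.const 0
    · exact Primrec.fst.comp (Primrec.snd.comp Primrec.snd)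
  exact Primrec.list_rec Primrec.id (Primrec.const ((0 : ℕ), ([] : List Bool))) h

/-- Universal machines exist. -/
theorem referenceMachine_isUniversal : referenceMachine.IsUniversal := by
  constructor
  · have hs : Computable fun x : List Bool × ℕ => splitIndex x.1 :=
      computable_splitIndex.comp Computable.fst
    exact Nat.Partrec.Code.eval_part.comp
      ((Computable.ofNat Nat.Partrec.Code).comp (Computable.fst.comp hs))
      (Computable.encode.comp (Computable.pair (Computable.snd.comp hs) Computable.snd))
  · intro V hV
    obtain ⟨code, hcode⟩ := Nat.Partrec.Code.exists_code.1 hV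
    refine ⟨Encodable.encode code + 1, fun p =>
      ⟨List.replicate (Encodable.encode code) true ++ false :: p, ?_, fun y => ?_⟩⟩
    · simp; omega
    · unfold referenceMachine
      rw [splitIndex_append]
      simp only [Denumerable.ofNat_encode]
      rw [hcode]
      simp [Encodable.encodek, Part.map_id']

/-! ### Labelled graphs and their randomness deficiency -/

/-- The nodes of a graph on `n` nodes carry the labels `1, …, n`. -/
def label {n : ℕ} (u : Fin n) : ℕ := u.val + 1

open Classical in
/-- The string `E(G)` of length `n(n-1)/2`: one bit for each possible edge `{u, v}`, `u < v`, in
lexicographic order, which is `1` iff the edge is present. -/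
noncomputable def edgeString {n : ℕ} (G : SimpleGraph (Fin n)) : List Bool :=
  (List.finRange n).flatMap fun u =>
    ((List.finRange n).filter fun v => u < v).map fun v => decide (G.Adj u v)

/-- `G` has randomness deficiency at most `δ` in the family of all labelled graphs on `n` nodes:
`C(E(G) | n, a) ≥ n(n-1)/2 - δ`. The number `a` stands for whatever finite description of the
function `δ` and of the family of graphs is supplied along with `n`. -/
def IsRandomGraph (U : Machine) (a : ℕ) (δ : ℝ) {n : ℕ} (G : SimpleGraph (Fin n)) : Prop :=
  (n : ℝ) * ((n : ℝ) - 1) / 2 - δ ≤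
    (condComplexity U (Encodable.encode (edgeString G)) (Encodable.encode (n, a)) : ℝ)

/-! ### Routing when the neighbours are known and nodes are not relabelled -/

open Classical in
/-- The labels of the neighbours of `u`, in increasing order. -/
noncomputable def neighbourLabels {n : ℕ} (G : SimpleGraph (Fin n)) (u : Fin n) : List ℕ :=
  ((List.finRange n).filter fun v => G.Adj u v).map label

/-- `F u` is the string stored at node `u`, a program in the language `R` for the local routing
function of `u`. For free the node knows its own label and the labels of its neighbours.
`Forwards R G F v u w`: at `u`, a message with destination `v` is sent over the edge to the
neighbour `w`. -/
def Forwards (R : Machine) {n : ℕ} (G : SimpleGraph (Fin n)) (F : Fin n → List Bool)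
    (v u w : Fin n) : Prop :=
  G.Adj u w ∧
    label w ∈ R (F u) (Encodable.encode (label u, neighbourLabels G u, label v))

/-- `Route R G F v u k`: the route from `u` to `v` that the routing scheme `F` produces reaches
`v` after exactly `k` edges. -/
inductive Route (R : Machine) {n : ℕ} (G : SimpleGraph (Fin n)) (F : Fin n → List Bool)
    (v : Fin n) : Fin n → ℕ → Prop
  | arrive : Route R G F v v 0
  | step {u w : Fin n} {k : ℕ} (hne : u ≠ v) (hfwd : Forwards R G F v u w)
      (hrest : Route R G F v w k) : Route R G F v u (k + 1)

/-- The scheme `F` routes between all pairs of distinct nodes, and the length of each route is at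
most `s` times the distance of its endpoints. -/
def HasStretchAtMost (R : Machine) {n : ℕ} (G : SimpleGraph (Fin n)) (F : Fin n → List Bool)
    (s : ℝ) : Prop :=
  ∀ u v : Fin n, u ≠ v → ∃ k : ℕ, Route R G F v u k ∧ (k : ℝ) ≤ s * (G.dist u v : ℝ)

end CompactRouting

/-!
A graph property that is decidable from the edge string, and that a fraction `ε` of all graphs on
`n` nodes satisfies, cannot hold for a `c log n`-random graph once `n ^ c * ε` is small: the index
of a graph among those with the property would describe it with `log (1 / ε)` fewer bits than its
edge string has. In a uniformly random graph the edges are independent, so that three properties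
are rare: that some node has no neighbour among the first `d log n` nodes, where `d > c + 1`; that
some two nodes have no common neighbour; and that the least common neighbours of some node `w` with
the others take more than `3n - k` bits when their places among the neighbours of `w` are coded in
unary. The last is a Markov bound for an exponential moment of the code length: given the
neighbours of `w`, the places are independent and geometrically distributed.

So the first `d log n` nodes serve as routing centres and store this unary code, while every other
node stores only a program of constant length that forwards to its least neighbour, which is a
centre. A message for a node at distance two or more then arrives after at most three edges.
-/

namespace CompactRouting

open Filter Topology

open scoped BigOperators

/-! ### Compressing the members of small computable families -/

/-- All binary strings of length `k`, in lexicographic order; a string of length `k` serves as a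
program that stands for its index in this list. -/
def bitStrings : ℕ → List (List Bool)
  | 0 => [[]]
  | k + 1 => (bitStrings k).map (List.cons false) ++ (bitStrings k).map (List.cons true)

theorem primrec_bitStrings : Primrec bitStrings := by
  have hstep : Primrec fun r : List (List Bool) =>
      r.map (List.cons false) ++ r.map (List.cons true) :=
    Primrec.list_append.comp
      (Primrec.list_map Primrec.id (Primrec.list_cons.comp₂ (Primrec₂.const false) Primrec₂.right))
      (Primrec.list_map Primrec.id (Primrec.list_cons.comp₂ (Primrec₂.const true) Primrec₂.right))
  refine (Primrec.nat_rec₁ [[]] (hstep.comp₂ Primrec₂.right)).of_eq fun k => ?_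
  induction k with
  | zero => rfl
  | succ k ih => rw [bitStrings, ← ih]

theorem mem_bitStrings {k : ℕ} {s : List Bool} : s ∈ bitStrings k ↔ s.length = k := by
  induction k generalizing s with
  | zero => simp [bitStrings]
  | succ k ih =>
    rcases s with _ | ⟨b, s⟩
    · simp [bitStrings]
    · cases b <;> simp [bitStrings, ih]

theorem nodup_bitStrings (k : ℕ) : (bitStrings k).Nodup := by
  induction k with
  | zero => simp [bitStrings]
  | succ k ih =>
    refine (ih.map List.cons_injective).append (ih.map List.cons_injective) ?_
    simp [List.disjoint_left]

theorem length_bitStrings (k : ℕ) : (bitStrings k).length = 2 ^ k := by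
  induction k with
  | zero => rfl
  | succ k ih => simp [bitStrings, ih, pow_succ, mul_two]

theorem Machine.IsUniversal.exists_program {U : Machine} (hU : U.IsUniversal)
    {f : List Bool → ℕ → ℕ} (hf : Computable₂ f) :
    ∃ k : ℕ, ∀ p : List Bool, ∃ q : List Bool,
      q.length ≤ p.length + k ∧ ∀ y : ℕ, U q y = Part.some (f p y) :=
  hU.2 (fun p y => Part.some (f p y)) hf.partrec₂

theorem condComplexity_le_length {U : Machine} {p : List Bool} {x y : ℕ} (h : x ∈ U p y) :
    condComplexity U x y ≤ p.length :=
  Nat.sInf_le ⟨p, rfl, h⟩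

theorem Machine.IsUniversal.condComplexity_le_of_mem {U : Machine} (hU : U.IsUniversal)
    {A : ℕ → List ℕ} (hA : Computable A) :
    ∃ k : ℕ, ∀ {x y l : ℕ}, x ∈ A y → (A y).length ≤ 2 ^ l → condComplexity U x y ≤ l + k := by
  have hidx : Computable fun p : List Bool => (bitStrings p.length).idxOf p :=
    (Primrec.list_idxOf.comp Primrec.id
      (primrec_bitStrings.comp Primrec.list_length)).to_comp.of_eq fun p => by congr!
  have hf : Computable₂ fun (p : List Bool) (y : ℕ) =>
      (A y).getD ((bitStrings p.length).idxOf p) 0 :=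
    (Primrec.list_getD 0).to_comp.comp (hA.comp Computable.snd) (hidx.comp Computable.fst)
  obtain ⟨k, hk⟩ := hU.exists_program hf
  refine ⟨k, fun {x y l} hx hl => ?_⟩
  obtain ⟨j, hj, rfl⟩ := List.mem_iff_getElem.1 hx
  have hj' : j < (bitStrings l).length := by rw [length_bitStrings]; exact hj.trans_le hl
  obtain ⟨q, hq, hqy⟩ := hk (bitStrings l)[j]
  have hlen : ((bitStrings l)[j]).length = l := mem_bitStrings.1 (List.getElem_mem hj')
  rw [hlen] at hq
  refine (condComplexity_le_length (p := q) ?_).trans hq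
  rw [hqy, hlen, (nodup_bitStrings l).idxOf_getElem, List.getD_eq_getElem _ _ hj]
  exact Part.mem_some _

/-! ### Uniformly random graphs -/

section RandomGraph

variable {V : Type*}

/-- `G` with the status of the pair `{u, v}` reversed: a measure preserving involution of the
space of all graphs, which exhibits the independence of that pair from the others. -/
def toggle (u v : V) (G : SimpleGraph V) : SimpleGraph V := symmDiff G (SimpleGraph.edge u v)

theorem toggle_involutive (u v : V) : Function.Involutive (toggle u v) :=
  fun _ => symmDiff_symmDiff_cancel_right _ _

theorem toggle_adj_self {u v : V} (huv : u ≠ v) (G : SimpleGraph V) :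
    (toggle u v G).Adj u v ↔ ¬ G.Adj u v := by
  simp [toggle, symmDiff, SimpleGraph.edge_adj, huv]

theorem toggle_adj_of_ne {u v a b : V} (h : s(a, b) ≠ s(u, v)) (G : SimpleGraph V) :
    (toggle u v G).Adj a b ↔ G.Adj a b := by
  simp [toggle, symmDiff, SimpleGraph.adj_edge, Ne.symm h]

variable [Fintype (SimpleGraph V)]

open Classical in
theorem expect_ite_adj {u v : V} (huv : u ≠ v) {f g : SimpleGraph V → ℝ}
    (hf : ∀ G, f (toggle u v G) = f G) (hg : ∀ G, g (toggle u v G) = g G) :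
    𝔼 G : SimpleGraph V, (if G.Adj u v then f G else g G) = (𝔼 G, f G + 𝔼 G, g G) / 2 := by
  have hswap : 𝔼 G : SimpleGraph V, (if G.Adj u v then f G else g G) =
      𝔼 G : SimpleGraph V, if G.Adj u v then g G else f G :=
    Fintype.expect_bijective _ (toggle_involutive u v).bijective _ _ fun G => by
      simp only [toggle_adj_self huv, hf, hg, ite_not]
  have hadd : 𝔼 G : SimpleGraph V, (if G.Adj u v then f G else g G) +
      𝔼 G : SimpleGraph V, (if G.Adj u v then g G else f G) = 𝔼 G, f G + 𝔼 G, g G := by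
    simp only [← Finset.expect_add_distrib]
    refine Finset.expect_congr rfl fun G _ => ?_
    split_ifs
    · rfl
    · exact add_comm _ _
  linarith

open Classical in
/-- The probability of the event `P` for a uniformly random graph on `V`, as the expectation of
its indicator. -/
noncomputable def graphProb (P : SimpleGraph V → Prop) : ℝ := 𝔼 G, if P G then 1 else 0

theorem graphProb_mul_le_expect {P : SimpleGraph V → Prop} {X : SimpleGraph V → ℝ} {t : ℝ}
    (hX : ∀ G, 0 ≤ X G) (hP : ∀ G, P G → t ≤ X G) : graphProb P * t ≤ 𝔼 G, X G := by
  rw [graphProb, Finset.expect_mul]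
  refine Finset.expect_le_expect fun G _ => ?_
  split_ifs with hG
  · simpa using hP G hG
  · simpa using hX G

theorem graphProb_mono {P Q : SimpleGraph V → Prop} (h : ∀ G, P G → Q G) :
    graphProb P ≤ graphProb Q := by
  refine Finset.expect_le_expect fun G _ => ?_
  have := h G
  split_ifs <;> simp_all

theorem graphProb_exists_le {ι : Type*} [Fintype ι] {P : ι → SimpleGraph V → Prop} {b : ℝ}
    (hP : ∀ i, graphProb (P i) ≤ b) : graphProb (fun G => ∃ i, P i G) ≤ Fintype.card ι * b := by
  classical
  calc graphProb (fun G => ∃ i, P i G) ≤ ∑ i, graphProb (P i) := by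
        simp only [graphProb, ← Finset.expect_sum_comm]
        refine Finset.expect_le_expect fun G _ => ?_
        split_ifs with hG
        · obtain ⟨i, hi⟩ := hG
          refine le_of_eq_of_le (if_pos hi).symm
            (Finset.single_le_sum (f := fun i => if P i G then (1 : ℝ) else 0) ?_
              (Finset.mem_univ i))
          exact fun j _ => by positivity
        · exact Finset.sum_nonneg fun i _ => by positivity
    _ ≤ Fintype.card ι * b := by
        simpa using Finset.sum_le_card_nsmul Finset.univ _ b fun i _ => hP i

open Classical in
theorem graphProb_ite_adj {u v : V} (huv : u ≠ v) {P Q : SimpleGraph V → Prop}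
    (hP : ∀ G, P (toggle u v G) ↔ P G) (hQ : ∀ G, Q (toggle u v G) ↔ Q G) :
    graphProb (fun G => if G.Adj u v then P G else Q G) = (graphProb P + graphProb Q) / 2 := by
  simp only [graphProb]
  rw [← expect_ite_adj huv (fun G => by simp only [hP]) fun G => by simp only [hQ]]
  exact Finset.expect_congr rfl fun G _ => by split_ifs <;> rfl

theorem graphProb_forall_not_adj {S : Finset V} {v : V} (hv : v ∉ S) :
    graphProb (fun G : SimpleGraph V => ∀ x ∈ S, ¬ G.Adj x v) = (1 / 2) ^ S.card := by
  classical
  induction S using Finset.induction_on with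
  | empty => simp [graphProb]
  | insert y S hy ih =>
    rw [Finset.mem_insert, not_or] at hv
    have hinv (G : SimpleGraph V) :
        (∀ x ∈ S, ¬ (toggle y v G).Adj x v) ↔ ∀ x ∈ S, ¬ G.Adj x v :=
      forall₂_congr fun x hx => not_congr (toggle_adj_of_ne (by grind) G)
    calc graphProb (fun G : SimpleGraph V => ∀ x ∈ insert y S, ¬ G.Adj x v)
        = graphProb (fun G : SimpleGraph V =>
            if G.Adj y v then False else ∀ x ∈ S, ¬ G.Adj x v) := by
          simp only [Finset.forall_mem_insert, if_false_left]
      _ = (0 + (1 / 2) ^ S.card) / 2 := by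
          rw [graphProb_ite_adj (Ne.symm hv.1) (fun _ => Iff.rfl) hinv, ih hv.2]
          simp [graphProb]
      _ = (1 / 2) ^ (insert y S).card := by
          rw [Finset.card_insert_of_notMem hy]
          ring

theorem graphProb_forall_not_adj_and_adj {S : Finset V} {u v : V} (huv : u ≠ v) (hu : u ∉ S)
    (hv : v ∉ S) :
    graphProb (fun G : SimpleGraph V => ∀ x ∈ S, ¬ (G.Adj u x ∧ G.Adj x v)) =
      (3 / 4) ^ S.card := by
  classical
  induction S using Finset.induction_on with
  | empty => simp [graphProb]
  | insert y S hy ih =>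
    rw [Finset.mem_insert, not_or] at hu hv
    have hinv {a b : V} (hab : s(a, b) = s(u, y) ∨ s(a, b) = s(y, v)) (G : SimpleGraph V) :
        (∀ x ∈ S, ¬ ((toggle a b G).Adj u x ∧ (toggle a b G).Adj x v)) ↔
          ∀ x ∈ S, ¬ (G.Adj u x ∧ G.Adj x v) :=
      forall₂_congr fun x hx => not_congr (and_congr (toggle_adj_of_ne (by grind) G)
        (toggle_adj_of_ne (by grind) G))
    have hyv (G : SimpleGraph V) : (toggle u y G).Adj y v ↔ G.Adj y v :=
      toggle_adj_of_ne (by grind) G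
    calc graphProb (fun G : SimpleGraph V => ∀ x ∈ insert y S, ¬ (G.Adj u x ∧ G.Adj x v))
        = graphProb (fun G : SimpleGraph V => if G.Adj u y then
            if G.Adj y v then False else ∀ x ∈ S, ¬ (G.Adj u x ∧ G.Adj x v)
            else ∀ x ∈ S, ¬ (G.Adj u x ∧ G.Adj x v)) := by
          congr! 2 with G
          simp only [Finset.forall_mem_insert]
          split_ifs <;> simp_all
      _ = ((0 + (3 / 4) ^ S.card) / 2 + (3 / 4) ^ S.card) / 2 := by
          rw [graphProb_ite_adj hu.1 (fun G => by simp only [hyv, hinv (Or.inl rfl)])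
              (hinv (Or.inl rfl)),
            graphProb_ite_adj (Ne.symm hv.1) (fun _ => Iff.rfl) (hinv (Or.inr rfl)),
            ih hu.2 hv.2]
          simp [graphProb]
      _ = (3 / 4) ^ (insert y S).card := by
          rw [Finset.card_insert_of_notMem hy]
          ring

end RandomGraph

/-! ### Relays in a random graph -/

section Relay

variable {V : Type*} [DecidableEq V]

/-- The relay over which `w` reaches `v`, for the adjacency relation `A`: its place among the
neighbours of `w` in the list `L` of all nodes, and `0` where no relay is needed. -/
def relayIndex (A : V → V → Bool) (L : List V) (w v : V) : ℕ :=
  if v = w ∨ A w v then 0 else (L.filter (A w)).findIdx fun x => A x v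

theorem relayIndex_map {W : Type*} [DecidableEq W] {f : V → W} (hf : Function.Injective f)
    {A : V → V → Bool} {A' : W → W → Bool} (hA : ∀ x y, A' (f x) (f y) = A x y) (L : List V)
    (w v : V) : relayIndex A' (L.map f) (f w) (f v) = relayIndex A L w v := by
  simp [relayIndex, hf.eq_iff, hA, List.filter_map, List.findIdx_map, Function.comp_def]

end Relay

section RelayMoment

variable {V : Type*}

open Classical in
/-- Adjacency in `G` as a Boolean relation, in the form that `relayIndex` expects. -/
noncomputable def boolAdj (G : SimpleGraph V) (u v : V) : Bool := decide (G.Adj u v)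

theorem boolAdj_eq_true {G : SimpleGraph V} {u v : V} : boolAdj G u v = true ↔ G.Adj u v := by
  simp [boolAdj]

theorem boolAdj_toggle {u v a b : V} (h : s(a, b) ≠ s(u, v)) (G : SimpleGraph V) :
    boolAdj (toggle u v G) a b = boolAdj G a b := by
  rw [Bool.eq_iff_iff, boolAdj_eq_true, boolAdj_eq_true, toggle_adj_of_ne h]

theorem findIdx_congr {α : Type*} {xs : List α} {p q : α → Bool} (h : ∀ x ∈ xs, p x = q x) :
    xs.findIdx p = xs.findIdx q := by
  induction xs with
  | nil => rfl
  | cons x xs ih =>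
    rw [List.forall_mem_cons] at h
    rw [List.findIdx_cons, List.findIdx_cons, h.1, ih h.2]

theorem expect_le_of_forall_fiber {α β : Type*} [Fintype α] [Nonempty α] [DecidableEq β]
    (N : α → β) {F : α → ℝ} {C : ℝ}
    (hF : ∀ a₀, 𝔼 a, (if N a = N a₀ then F a else 0) ≤ C * 𝔼 a, if N a = N a₀ then 1 else 0) :
    𝔼 a, F a ≤ C := by
  have htotal (X : α → ℝ) :
      𝔼 a, X a = ∑ y ∈ Finset.univ.image N, 𝔼 a, if N a = y then X a else 0 := by
    rw [← Finset.expect_sum_comm]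
    exact Finset.expect_congr rfl fun a _ => by simp
  calc 𝔼 a, F a ≤ ∑ y ∈ Finset.univ.image N, C * 𝔼 a, if N a = y then 1 else 0 := by
        rw [htotal]
        refine Finset.sum_le_sum fun y hy => ?_
        obtain ⟨a₀, -, rfl⟩ := Finset.mem_image.1 hy
        exact hF a₀
    _ = C := by rw [← Finset.mul_sum, ← htotal, Fintype.expect_const, mul_one]

theorem filter_boolAdj_toggle {w x v : V} (hwx : w ≠ x) (hwv : w ≠ v) (L : List V)
    (G : SimpleGraph V) : L.filter (boolAdj (toggle x v G) w) = L.filter (boolAdj G w) :=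
  List.filter_congr fun y _ => boolAdj_toggle (by grind) G

theorem findIdx_boolAdj_toggle {xs : List V} {x v v' : V} (hv' : v' ≠ v) (hv : v ∉ xs)
    (G : SimpleGraph V) :
    xs.findIdx (fun y => boolAdj (toggle x v G) y v') = xs.findIdx fun y => boolAdj G y v' :=
  findIdx_congr fun y hy => boolAdj_toggle (by grind) G

theorem relayIndex_toggle [DecidableEq V] {L : List V} {w x v v' : V} {G : SimpleGraph V}
    (hwx : w ≠ x) (hwv : w ≠ v) (hv : ¬ G.Adj w v) (hv' : v' ≠ v) :
    relayIndex (boolAdj (toggle x v G)) L w v' = relayIndex (boolAdj G) L w v' := by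
  rw [relayIndex, filter_boolAdj_toggle hwx hwv, boolAdj_toggle (by grind),
    findIdx_boolAdj_toggle hv' (by simp [boolAdj, hv]), relayIndex]

theorem sum_relayIndex_toggle [DecidableEq V] {L Y : List V} {w x v : V} {G : SimpleGraph V}
    (hwx : w ≠ x) (hwv : w ≠ v) (hv : ¬ G.Adj w v) (hY : v ∉ Y) :
    (Y.map fun v' => relayIndex (boolAdj (toggle x v G)) L w v' + 1).sum =
      (Y.map fun v' => relayIndex (boolAdj G) L w v' + 1).sum := by
  refine congrArg List.sum (List.map_congr_left fun v' hv' => ?_)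
  rw [relayIndex_toggle hwx hwv hv (ne_of_mem_of_not_mem hv' hY)]

variable [Fintype (SimpleGraph V)]

theorem expect_pow_findIdx_mul_le {b : ℝ} (hb : 1 ≤ b) (hb2 : b < 2) {xs : List V}
    (hxs : xs.Nodup) {v : V} (hv : v ∉ xs) {h : SimpleGraph V → ℝ} (hpos : ∀ G, 0 ≤ h G)
    (hh : ∀ x ∈ xs, ∀ G, h (toggle x v G) = h G) :
    𝔼 G : SimpleGraph V, b ^ (xs.findIdx (fun x => boolAdj G x v) + 1) * h G ≤
      b / (2 - b) * 𝔼 G, h G := by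
  classical
  have hb' : 0 < 2 - b := by linarith
  induction xs with
  | nil =>
    rw [Finset.mul_expect]
    refine Finset.expect_le_expect fun G _ => mul_le_mul_of_nonneg_right ?_ (hpos G)
    rw [List.findIdx_nil, zero_add, pow_one, le_div_iff₀ hb']
    nlinarith
  | cons x xs ih =>
    rw [List.nodup_cons] at hxs
    rw [List.mem_cons, not_or] at hv
    rw [List.forall_mem_cons] at hh
    have htail (G : SimpleGraph V) :
        xs.findIdx (fun y => boolAdj (toggle x v G) y v) = xs.findIdx fun y => boolAdj G y v :=
      findIdx_congr fun y hy => boolAdj_toggle (by grind) G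
    calc 𝔼 G : SimpleGraph V, b ^ ((x :: xs).findIdx (fun y => boolAdj G y v) + 1) * h G
        = 𝔼 G : SimpleGraph V, if G.Adj x v then b * h G else
            b * (b ^ (xs.findIdx (fun y => boolAdj G y v) + 1) * h G) := by
          refine Finset.expect_congr rfl fun G _ => ?_
          by_cases hG : G.Adj x v
          · simp [List.findIdx_cons, boolAdj, hG]
          · simp [List.findIdx_cons, boolAdj, hG, pow_succ']
            ring
      _ = (b * 𝔼 G, h G + b * 𝔼 G : SimpleGraph V,
            b ^ (xs.findIdx (fun y => boolAdj G y v) + 1) * h G) / 2 := by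
          rw [expect_ite_adj (Ne.symm hv.1) (fun G => by rw [hh.1])
              fun G => by rw [hh.1, htail],
            Finset.mul_expect, Finset.mul_expect]
      _ ≤ (b * 𝔼 G, h G + b * (b / (2 - b) * 𝔼 G, h G)) / 2 := by
          gcongr
          exact ih hxs.2 hv.2 hh.2
      _ = b / (2 - b) * 𝔼 G, h G := by
          field_simp
          ring

variable [DecidableEq V]

theorem expect_pow_relayIndex_mul_le {b : ℝ} (hb : 1 ≤ b) (hb2 : b < 2) {L xs : List V}
    (hxs : xs.Nodup) {w v : V} (hv : v ∈ L) {h : SimpleGraph V → ℝ} (hpos : ∀ G, 0 ≤ h G)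
    (hfib : ∀ G, h G ≠ 0 → L.filter (boolAdj G w) = xs)
    (hh : v ≠ w → v ∉ xs → ∀ x ∈ xs, ∀ G, h (toggle x v G) = h G) :
    𝔼 G : SimpleGraph V, b ^ (relayIndex (boolAdj G) L w v + 1) * h G ≤
      b / (2 - b) * 𝔼 G, h G := by
  have hrelay {G : SimpleGraph V} (hG : h G ≠ 0) : relayIndex (boolAdj G) L w v =
      if v = w ∨ v ∈ xs then 0 else xs.findIdx fun x => boolAdj G x v := by
    simp [relayIndex, ← hfib G hG, hv]
  by_cases hvw : v = w ∨ v ∈ xs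
  · rw [Finset.mul_expect]
    refine Finset.expect_le_expect fun G _ => ?_
    rcases eq_or_ne (h G) 0 with h0 | h0
    · simp [h0]
    · rw [hrelay h0, if_pos hvw, zero_add, pow_one]
      exact mul_le_mul_of_nonneg_right
        (by rw [le_div_iff₀ (by linarith)]; nlinarith) (hpos G)
  · rw [not_or] at hvw
    refine le_of_eq_of_le (Finset.expect_congr rfl fun G _ => ?_)
      (expect_pow_findIdx_mul_le hb hb2 hxs hvw.2 hpos (hh hvw.1 hvw.2))
    rcases eq_or_ne (h G) 0 with h0 | h0
    · simp [h0]
    · rw [hrelay h0, if_neg (not_or.2 hvw)]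

/-- Conditioned on the neighbours of `w`, the edges between them and the other nodes are
independent, so that the relays of different destinations contribute independent factors. -/
theorem expect_pow_sum_relayIndex_fiber_le {b : ℝ} (hb : 1 ≤ b) (hb2 : b < 2) {L : List V}
    (hL : L.Nodup) (w : V) (G₀ : SimpleGraph V) {Y : List V} (hY : Y.Nodup) (hYL : Y ⊆ L) :
    𝔼 G : SimpleGraph V, (if L.filter (boolAdj G w) = L.filter (boolAdj G₀ w) then
        b ^ (Y.map fun v => relayIndex (boolAdj G) L w v + 1).sum else 0) ≤
      (b / (2 - b)) ^ Y.length *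
        𝔼 G : SimpleGraph V,
          if L.filter (boolAdj G w) = L.filter (boolAdj G₀ w) then 1 else 0 := by
  induction Y with
  | nil => simp
  | cons v Y ih =>
    rw [List.nodup_cons] at hY
    rw [List.cons_subset] at hYL
    set xs := L.filter (boolAdj G₀ w)
    set h : SimpleGraph V → ℝ := fun G => if L.filter (boolAdj G w) = xs then
      b ^ (Y.map fun v => relayIndex (boolAdj G) L w v + 1).sum else 0 with hh
    have hinv (hvw : v ≠ w) (hv : v ∉ xs) (x : V) (hx : x ∈ xs) (G : SimpleGraph V) :
        h (toggle x v G) = h G := by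
      have hwx : w ≠ x := by
        rintro rfl
        simp [xs, boolAdj] at hx
      simp only [hh, filter_boolAdj_toggle hwx hvw.symm]
      split_ifs with hG
      · rw [sum_relayIndex_toggle hwx hvw.symm (fun hwv => hv ?_) hY.1]
        simpa [← hG, hYL.1, boolAdj] using hwv
      · rfl
    calc 𝔼 G : SimpleGraph V, (if L.filter (boolAdj G w) = xs then
          b ^ ((v :: Y).map fun v => relayIndex (boolAdj G) L w v + 1).sum else 0)
        = 𝔼 G : SimpleGraph V, b ^ (relayIndex (boolAdj G) L w v + 1) * h G := by
          simp only [hh, List.map_cons, List.sum_cons, pow_add, mul_ite, mul_zero]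
      _ ≤ b / (2 - b) * 𝔼 G, h G :=
          expect_pow_relayIndex_mul_le hb hb2 (hL.filter _) hYL.1
            (fun G => by rw [hh]; positivity)
            (fun G hG => by_contra fun hne => hG (if_neg hne)) hinv
      _ ≤ b / (2 - b) * ((b / (2 - b)) ^ Y.length * 𝔼 G : SimpleGraph V,
            if L.filter (boolAdj G w) = xs then 1 else 0) :=
          mul_le_mul_of_nonneg_left (ih hY.2 hYL.2) (div_nonneg (by linarith) (by linarith))
      _ = _ := by rw [List.length_cons, pow_succ, ← mul_assoc, mul_comm (b / (2 - b))]

theorem expect_pow_sum_relayIndex_le {b : ℝ} (hb : 1 ≤ b) (hb2 : b < 2) {L : List V}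
    (hL : L.Nodup) (w : V) :
    𝔼 G : SimpleGraph V, b ^ (L.map fun v => relayIndex (boolAdj G) L w v + 1).sum ≤
      (b / (2 - b)) ^ L.length :=
  expect_le_of_forall_fiber (fun G => L.filter (boolAdj G w)) fun G₀ =>
    expect_pow_sum_relayIndex_fiber_le hb hb2 hL w G₀ hL (List.Subset.refl L)

theorem graphProb_le_sum_relayIndex_le {L : List V} (hL : L.Nodup) (w : V) (t : ℕ) :
    graphProb (fun G => t ≤ (L.map fun v => relayIndex (boolAdj G) L w v + 1).sum) ≤
      2 ^ L.length * (3 / 4) ^ t := by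
  have hmarkov := graphProb_mul_le_expect (t := (4 / 3) ^ t)
    (P := fun G => t ≤ (L.map fun v => relayIndex (boolAdj G) L w v + 1).sum)
    (X := fun G => (4 / 3) ^ (L.map fun v => relayIndex (boolAdj G) L w v + 1).sum)
    (fun G => by positivity) fun G hG => pow_le_pow_right₀ (by norm_num) hG
  have hmoment := expect_pow_sum_relayIndex_le (b := 4 / 3) (by norm_num) (by norm_num) hL w
  rw [show (3 / 4 : ℝ) = (4 / 3)⁻¹ by norm_num, inv_pow, ← div_eq_mul_inv,
    le_div_iff₀ (by positivity)]
  convert hmarkov.trans hmoment using 2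
  norm_num

end RelayMoment

/-! ### Edge strings -/

section OrderedPairs

variable {α β : Type*} [LinearOrder α] [LinearOrder β]

/-- The pairs `(u, v)` of members of `l` with `u < v`, listed as the bits of an `edgeString`. -/
def orderedPairs (l : List α) : List (α × α) :=
  l.flatMap fun u => (l.filter (u < ·)).map (Prod.mk u)

theorem mem_orderedPairs {l : List α} {e : α × α} :
    e ∈ orderedPairs l ↔ e.1 ∈ l ∧ e.2 ∈ l ∧ e.1 < e.2 := by
  obtain ⟨u, v⟩ := e
  simp [orderedPairs]

theorem nodup_orderedPairs {l : List α} (hl : l.Nodup) : (orderedPairs l).Nodup := by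
  refine List.nodup_flatMap.2 ⟨fun u _ => (hl.filter _).map (Prod.mk_right_injective u), ?_⟩
  refine hl.imp fun {u u'} huu' => List.disjoint_left.2 ?_
  simp only [List.mem_map, List.mem_filter]
  rintro _ ⟨v, -, rfl⟩ ⟨v', -, he⟩
  exact huu' (congrArg Prod.fst he).symm

theorem orderedPairs_map {f : α → β} (hf : StrictMono f) (l : List α) :
    orderedPairs (l.map f) = (orderedPairs l).map (Prod.map f f) := by
  simp [orderedPairs, List.map_flatMap, List.flatMap_map, List.filter_map, Function.comp_def,
    hf.lt_iff_lt]

theorem orderedPairs_cons {x : α} {l : List α} (hx : ∀ y ∈ l, x < y) :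
    orderedPairs (x :: l) = l.map (Prod.mk x) ++ orderedPairs l := by
  rw [orderedPairs, List.flatMap_cons, List.filter_cons_of_neg (by simp),
    List.filter_eq_self.2 (by simpa using hx)]
  refine congrArg _ (List.flatMap_congr fun u hu => ?_)
  rw [List.filter_cons_of_neg (by simpa using (hx u hu).le)]

theorem length_orderedPairs {l : List α} (hl : l.Pairwise (· < ·)) :
    (orderedPairs l).length = l.length.choose 2 := by
  induction l with
  | nil => rfl
  | cons x l ih =>
    rw [List.pairwise_cons] at hl
    rw [orderedPairs_cons hl.1, List.length_append, List.length_map, ih hl.2, List.length_cons,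
      Nat.choose_succ_succ' l.length 1, Nat.choose_one_right]

end OrderedPairs

/-- The bit for the pair `{u, v}` in the edge string `s` of a graph on `{0, …, n - 1}`. -/
def adjBit (n : ℕ) (s : List Bool) (u v : ℕ) : Bool :=
  s.getD ((orderedPairs (List.range n)).idxOf (min u v, max u v)) false

theorem primrec_adjBit {α : Type*} [Primcodable α] {f : α → ℕ} {g : α → List Bool} {u v : α → ℕ}
    (hf : Primrec f) (hg : Primrec g) (hu : Primrec u) (hv : Primrec v) :
    Primrec fun a => adjBit (f a) (g a) (u a) (v a) := by
  have hpairs : Primrec fun n => orderedPairs (List.range n) :=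
    Primrec.list_flatMap Primrec.list_range <|
      Primrec.list_map
        ((PrimrecRel.listFilter (Primrec.nat_lt.swap)).comp
          (Primrec.list_range.comp Primrec.fst) Primrec.snd)
        ((Primrec.snd.comp Primrec.fst).pair Primrec.snd)
  exact ((Primrec.list_getD false).comp hg (Primrec.list_idxOf.comp
    ((Primrec.nat_min.comp hu hv).pair (Primrec.nat_max.comp hu hv))
    (hpairs.comp hf))).of_eq fun a => by rw [adjBit]; congr!

theorem adjBit_comm (n : ℕ) (s : List Bool) (u v : ℕ) : adjBit n s u v = adjBit n s v u := by
  rw [adjBit, min_comm, max_comm, adjBit]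

theorem map_adjBit_orderedPairs {n : ℕ} {s : List Bool} (hs : s.length = n.choose 2) :
    (orderedPairs (List.range n)).map (fun e => adjBit n s e.1 e.2) = s := by
  have hlen : (orderedPairs (List.range n)).length = s.length := by
    rw [length_orderedPairs List.pairwise_lt_range, List.length_range, hs]
  refine List.ext_getElem (by rw [List.length_map, hlen]) fun i hi hi' => ?_
  obtain ⟨-, -, hlt⟩ := mem_orderedPairs.1 (List.getElem_mem (hi'.trans_eq hlen.symm))
  rw [List.getElem_map, adjBit, min_eq_left hlt.le, max_eq_right hlt.le,
    (nodup_orderedPairs List.nodup_range).idxOf_getElem, List.getD_eq_getElem _ _ hi']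

section EdgeString

variable {n : ℕ}

theorem orderedPairs_range :
    orderedPairs (List.range n) = (orderedPairs (List.finRange n)).map (Prod.map (↑) (↑)) := by
  rw [← List.map_coe_finRange_eq_range, orderedPairs_map Fin.val_strictMono]

theorem edgeString_eq_map (G : SimpleGraph (Fin n)) :
    edgeString G = (orderedPairs (List.finRange n)).map fun e => boolAdj G e.1 e.2 := by
  simp [edgeString, orderedPairs, List.map_flatMap, Function.comp_def, boolAdj]

theorem length_edgeString (G : SimpleGraph (Fin n)) : (edgeString G).length = n.choose 2 := by
  rw [edgeString_eq_map, List.length_map, length_orderedPairs (List.pairwise_lt_finRange n),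
    List.length_finRange]

theorem adjBit_edgeString (G : SimpleGraph (Fin n)) (u v : Fin n) :
    adjBit n (edgeString G) u v = boolAdj G u v := by
  have hmap : ∀ e ∈ orderedPairs (List.finRange n),
      adjBit n (edgeString G) e.1 e.2 = boolAdj G e.1 e.2 := by
    rw [← List.map_inj_left, ← edgeString_eq_map]
    simpa [orderedPairs_range, Function.comp_def] using
      map_adjBit_orderedPairs (length_edgeString G)
  rcases lt_trichotomy u v with h | rfl | h
  · exact hmap (u, v) (by simp [mem_orderedPairs, h])
  · have hnot : ((u : ℕ), (u : ℕ)) ∉ orderedPairs (List.range n) := by simp [mem_orderedPairs]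
    rw [adjBit, min_self, max_self, List.idxOf_eq_length hnot, List.getD_eq_default]
    · simp [boolAdj]
    · rw [length_edgeString, length_orderedPairs List.pairwise_lt_range, List.length_range]
  · rw [adjBit_comm, hmap (v, u) (by simp [mem_orderedPairs, h])]
    simp [boolAdj, G.adj_comm]

theorem edgeString_injective :
    Function.Injective (edgeString : SimpleGraph (Fin n) → List Bool) := by
  intro G H h
  ext u v
  rw [← boolAdj_eq_true, ← boolAdj_eq_true, ← adjBit_edgeString, h, adjBit_edgeString]

theorem exists_edgeString_eq {s : List Bool} (hs : s.length = n.choose 2) :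
    ∃ G : SimpleGraph (Fin n), edgeString G = s := by
  let G : SimpleGraph (Fin n) := SimpleGraph.fromRel fun u v => adjBit n s u v
  have hG {u v : Fin n} (huv : u ≠ v) : boolAdj G u v = adjBit n s u v := by
    simp [G, boolAdj, huv, adjBit_comm n s v u]
  refine ⟨G, ?_⟩
  calc edgeString G
      = (orderedPairs (List.finRange n)).map fun e => adjBit n s e.1 e.2 := by
        rw [edgeString_eq_map]
        exact List.map_congr_left fun e he => hG (mem_orderedPairs.1 he).2.2.ne
    _ = (orderedPairs (List.range n)).map fun e => adjBit n s e.1 e.2 := by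
        simp [orderedPairs_range, Function.comp_def]
    _ = s := map_adjBit_orderedPairs hs

theorem length_filter_bitStrings_choose_two {p : List Bool → Prop} [DecidablePred p] :
    ((bitStrings (n.choose 2)).filter p).length =
      Nat.card {G : SimpleGraph (Fin n) // p (edgeString G)} := by
  rw [← List.toFinset_card_of_nodup ((nodup_bitStrings _).filter _), ← Nat.card_eq_finsetCard]
  refine (Nat.card_congr (.ofBijective (fun G => ⟨edgeString G.1, ?mem⟩) ⟨?inj, ?surj⟩)).symm
  case mem => simpa [mem_bitStrings, length_edgeString] using G.2
  case inj => exact fun G H h => Subtype.ext (edgeString_injective (Subtype.mk.inj h))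
  case surj =>
    rintro ⟨s, hs⟩
    rw [List.mem_toFinset, List.mem_filter, mem_bitStrings, decide_eq_true_eq] at hs
    obtain ⟨G, rfl⟩ := exists_edgeString_eq hs.1
    exact ⟨⟨G, hs.2⟩, rfl⟩

theorem card_simpleGraph_fin : Nat.card (SimpleGraph (Fin n)) = 2 ^ n.choose 2 := by
  have h := length_filter_bitStrings_choose_two (n := n) (p := fun _ => True)
  simp only [decide_true, List.filter_true, length_bitStrings] at h
  rw [h, Nat.card_congr (Equiv.subtypeUnivEquiv fun _ => trivial)]

end EdgeString

/-! ### Rare properties of random graphs -/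

/-- A property of the graphs on `n` nodes, for every `n`, that a primitive recursive relation reads
off from `n` and the edge string. -/
def IsPrimrecGraphProperty (P : ∀ n : ℕ, SimpleGraph (Fin n) → Prop) : Prop :=
  ∃ p : ℕ → List Bool → Prop, PrimrecRel p ∧
    ∀ (n : ℕ) (G : SimpleGraph (Fin n)), p n (edgeString G) ↔ P n G

theorem graphProb_eq_card_div {V : Type*} [Fintype (SimpleGraph V)] (P : SimpleGraph V → Prop) :
    graphProb P = Nat.card {G // P G} / Nat.card (SimpleGraph V) := by
  classical
  rw [graphProb, Fintype.expect_eq_sum_div_card, Finset.sum_boole, Nat.card_eq_fintype_card,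
    Nat.card_eq_fintype_card, Fintype.card_subtype]

theorem primrec_filter_bitStrings_choose_two {p : ℕ → List Bool → Prop} [DecidableRel p]
    (hp : PrimrecRel p) : Primrec fun n : ℕ => (bitStrings (n.choose 2)).filter (p n) := by
  have hchoose : Primrec fun n : ℕ => n.choose 2 := by
    simp only [Nat.choose_two_right]
    exact Primrec.nat_div.comp (Primrec.nat_mul.comp Primrec.id
      (Primrec.nat_sub.comp Primrec.id (Primrec.const 1))) (Primrec.const 2)
  exact hp.swap.listFilter.comp (primrec_bitStrings.comp hchoose) Primrec.id

theorem Machine.IsUniversal.condComplexity_edgeString_le {U : Machine} (hU : U.IsUniversal)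
    {P : ∀ n : ℕ, SimpleGraph (Fin n) → Prop} (hP : IsPrimrecGraphProperty P) :
    ∃ k : ℕ, ∀ {n : ℕ} (a : ℕ) {G : SimpleGraph (Fin n)}, P n G →
      condComplexity U (Encodable.encode (edgeString G)) (Encodable.encode (n, a)) ≤
        Nat.log 2 (Nat.card {G // P n G}) + k := by
  classical
  obtain ⟨p, hp, hpP⟩ := hP
  have hA : Primrec fun y : ℕ => ((bitStrings ((Denumerable.ofNat (ℕ × ℕ) y).1.choose 2)).filter
      (p (Denumerable.ofNat (ℕ × ℕ) y).1)).map Encodable.encode :=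
    Primrec.list_map ((primrec_filter_bitStrings_choose_two hp).comp
      (Primrec.fst.comp (Primrec.ofNat (ℕ × ℕ)))) (Primrec.encode.comp₂ Primrec₂.right)
  obtain ⟨k, hk⟩ := hU.condComplexity_le_of_mem hA.to_comp
  refine ⟨k + 1, fun {n} a {G} hG => ?_⟩
  have hcard : Nat.card {G // P n G} = ((bitStrings (n.choose 2)).filter (p n)).length := by
    simp only [length_filter_bitStrings_choose_two, hpP]
  rw [hcard, add_comm k, ← add_assoc]
  refine hk (List.mem_map.2 ⟨edgeString G, ?_, rfl⟩) ?_
  · simp [mem_bitStrings, length_edgeString, hpP, hG]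
  · simpa using (Nat.lt_pow_succ_log_self one_lt_two _).le

theorem Machine.IsUniversal.two_rpow_neg_le_graphProb {U : Machine} (hU : U.IsUniversal)
    {P : ∀ n : ℕ, SimpleGraph (Fin n) → Prop} (hP : IsPrimrecGraphProperty P) :
    ∃ k : ℕ, ∀ {n a : ℕ} {δ : ℝ} {G : SimpleGraph (Fin n)}, IsRandomGraph U a δ G → P n G →
      (2 : ℝ) ^ (-(δ + k)) ≤ graphProb (P n) := by
  obtain ⟨k, hk⟩ := hU.condComplexity_edgeString_le hP
  refine ⟨k, fun {n a δ G} hG hPG => ?_⟩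
  have : Nonempty {G // P n G} := ⟨⟨G, hPG⟩⟩
  rw [graphProb_eq_card_div, card_simpleGraph_fin, Nat.cast_pow, Nat.cast_ofNat,
    le_div_iff₀ (by positivity)]
  calc (2 : ℝ) ^ (-(δ + k)) * 2 ^ n.choose 2
      = 2 ^ ((n.choose 2 : ℝ) - δ - k) := by
        rw [← Real.rpow_natCast 2 (n.choose 2), ← Real.rpow_add two_pos]
        ring_nf
    _ ≤ 2 ^ (Nat.log 2 (Nat.card {G // P n G}) : ℝ) := by
        refine Real.rpow_le_rpow_of_exponent_le one_le_two ?_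
        rw [IsRandomGraph, ← Nat.cast_choose_two] at hG
        have hC := Nat.cast_le (α := ℝ).2 (hk a hPG)
        push_cast at hC
        linarith
    _ ≤ Nat.card {G // P n G} := by
        exact_mod_cast Nat.pow_log_le_self 2 Nat.card_pos.ne'

theorem Machine.IsUniversal.eventually_not_of_isRandomGraph {U : Machine} (hU : U.IsUniversal)
    {P : ∀ n : ℕ, SimpleGraph (Fin n) → Prop} (hP : IsPrimrecGraphProperty P) {c : ℝ} {ε : ℕ → ℝ}
    (hε : ∀ᶠ n : ℕ in atTop, graphProb (P n) ≤ ε n)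
    (hlim : Tendsto (fun n : ℕ => (n : ℝ) ^ c * ε n) atTop (𝓝 0)) :
    ∀ᶠ n : ℕ in atTop, ∀ {a : ℕ} {G : SimpleGraph (Fin n)},
      IsRandomGraph U a (c * Real.logb 2 n) G → ¬ P n G := by
  obtain ⟨k, hk⟩ := hU.two_rpow_neg_le_graphProb hP
  filter_upwards [hε, hlim.eventually_lt_const (show (0 : ℝ) < 2 ^ (-(k : ℝ)) by positivity),
    eventually_gt_atTop 0] with n hεn hlimn hn a G hG hPG
  have hnpos : (0 : ℝ) < (n : ℝ) ^ c := by positivity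
  have hlow := (hk hG hPG).trans hεn
  rw [neg_add, Real.rpow_add two_pos, Real.rpow_neg zero_le_two, mul_comm c,
    Real.rpow_mul zero_le_two, Real.rpow_logb two_pos (by norm_num) (by exact_mod_cast hn),
    inv_mul_le_iff₀ hnpos] at hlow
  exact hlimn.not_ge hlow

theorem tendsto_rpow_mul_pow_mul_geometric (c : ℝ) (j : ℕ) (C : ℝ) {r : ℝ} (hr : 0 < r)
    (hr1 : r < 1) : Tendsto (fun n : ℕ => (n : ℝ) ^ c * (n ^ j * (C * r ^ n))) atTop (𝓝 0) := by
  have h := ((tendsto_rpow_mul_exp_neg_mul_atTop_nhds_zero (c + j) (-Real.log r)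
    (neg_pos.2 (Real.log_neg hr hr1))).comp tendsto_natCast_atTop_atTop).const_mul C
  rw [mul_zero] at h
  refine h.congr' ?_
  filter_upwards [eventually_gt_atTop 0] with n hn
  rw [Function.comp_apply, neg_neg, mul_comm (Real.log r), Real.exp_nat_mul, Real.exp_log hr,
    Real.rpow_add (by exact_mod_cast hn), Real.rpow_natCast]
  ring

/-! ### Three rare properties -/

section Primrec

variable {α : Type*} [Primcodable α]

theorem primrecPred_exists_lt {f : α → ℕ} {P : α → ℕ → Prop} (hf : Primrec f)
    (hP : PrimrecRel P) : PrimrecPred fun a => ∃ x < f a, P a x :=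
  (hP.swap.exists_mem_list.comp (Primrec.list_range.comp hf) Primrec.id).of_eq fun a => by simp

theorem primrecPred_forall_lt {f : α → ℕ} {P : α → ℕ → Prop} (hf : Primrec f)
    (hP : PrimrecRel P) : PrimrecPred fun a => ∀ x < f a, P a x :=
  (hP.swap.forall_mem_list.comp (Primrec.list_range.comp hf) Primrec.id).of_eq fun a => by simp

theorem primrec_sum {f : α → List ℕ} (hf : Primrec f) : Primrec fun a => (f a).sum :=
  Primrec.list_foldr hf (Primrec.const 0) (Primrec.nat_add.comp₂
    (Primrec.fst.comp₂ Primrec₂.right) (Primrec.snd.comp₂ Primrec₂.right))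

theorem primrec_log_two : Primrec (Nat.log 2) := by
  have hpow : Primrec fun k : ℕ => 2 ^ k :=
    (Primrec.list_length.comp primrec_bitStrings).of_eq length_bitStrings
  have hle : PrimrecRel fun n k : ℕ => 2 ^ k ≤ n :=
    Primrec.nat_le.comp (hpow.comp Primrec.snd) Primrec.fst
  refine (Primrec.nat_findGreatest Primrec.id hle).of_eq fun n => ?_
  rw [Nat.findGreatest_eq_iff]
  refine ⟨Nat.log_le_self 2 n, fun h0 => Nat.pow_log_le_self 2 ?_, fun k hk _ => ?_⟩
  · rintro rfl
    simp at h0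
  · exact (Nat.lt_pow_of_log_lt one_lt_two hk).not_ge

end Primrec

theorem adj_iff_adjBit_edgeString {n : ℕ} {G : SimpleGraph (Fin n)} {u v : Fin n} :
    G.Adj u v ↔ adjBit n (edgeString G) u v = true := by
  rw [adjBit_edgeString, boolAdj_eq_true]

theorem primrecPred_adjBit {α : Type*} [Primcodable α] {f : α → ℕ} {g : α → List Bool}
    {u v : α → ℕ} (hf : Primrec f) (hg : Primrec g) (hu : Primrec u) (hv : Primrec v) :
    PrimrecPred fun a => adjBit (f a) (g a) (u a) (v a) = true :=
  Primrec.eq.comp (primrec_adjBit hf hg hu hv) (Primrec.const true)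

theorem isPrimrecGraphProperty_exists_forall_lt_not_adj {m : ℕ → ℕ} (hm : Primrec m) :
    IsPrimrecGraphProperty fun n G =>
      ∃ u : Fin n, m n ≤ u ∧ ∀ x : Fin n, (x : ℕ) < m n → ¬ G.Adj x u := by
  refine ⟨fun n s => ∃ u < n, m n ≤ u ∧ ∀ x < n, x < m n → ¬ adjBit n s x u, ?_, fun n G => ?_⟩
  · have hn : Primrec fun a : ((ℕ × List Bool) × ℕ) × ℕ => a.1.1.1 :=
      Primrec.fst.comp (Primrec.fst.comp Primrec.fst)
    have hs : Primrec fun a : ((ℕ × List Bool) × ℕ) × ℕ => a.1.1.2 :=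
      Primrec.snd.comp (Primrec.fst.comp Primrec.fst)
    have hadj : PrimrecPred fun a : ((ℕ × List Bool) × ℕ) × ℕ =>
        adjBit a.1.1.1 a.1.1.2 a.2 a.1.2 = true :=
      primrecPred_adjBit hn hs Primrec.snd (Primrec.snd.comp Primrec.fst)
    have hbelow : PrimrecPred fun a : ((ℕ × List Bool) × ℕ) × ℕ => a.2 < m a.1.1.1 :=
      Primrec.nat_lt.comp Primrec.snd (hm.comp hn)
    refine primrecPred_exists_lt Primrec.fst (PrimrecPred.and
      (Primrec.nat_le.comp (hm.comp (Primrec.fst.comp Primrec.fst)) Primrec.snd)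
      (primrecPred_forall_lt (Primrec.fst.comp Primrec.fst) ?_))
    exact (hbelow.not.or hadj.not).of_eq fun a => imp_iff_not_or.symm
  · simp only [adj_iff_adjBit_edgeString, Fin.exists_iff, Fin.forall_iff, exists_prop]

theorem isPrimrecGraphProperty_exists_forall_not_adj_and_adj :
    IsPrimrecGraphProperty fun n G =>
      ∃ u v : Fin n, u ≠ v ∧ ∀ x : Fin n, ¬ (G.Adj u x ∧ G.Adj x v) := by
  refine ⟨fun n s => ∃ u < n, ∃ v < n, u ≠ v ∧ ∀ x < n, ¬ (adjBit n s u x ∧ adjBit n s x v), ?_,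
    fun n G => ?_⟩
  · have hn : Primrec fun a : (((ℕ × List Bool) × ℕ) × ℕ) × ℕ => a.1.1.1.1 :=
      Primrec.fst.comp (Primrec.fst.comp (Primrec.fst.comp Primrec.fst))
    have hs : Primrec fun a : (((ℕ × List Bool) × ℕ) × ℕ) × ℕ => a.1.1.1.2 :=
      Primrec.snd.comp (Primrec.fst.comp (Primrec.fst.comp Primrec.fst))
    have hu : Primrec fun a : (((ℕ × List Bool) × ℕ) × ℕ) × ℕ => a.1.1.2 :=
      Primrec.snd.comp (Primrec.fst.comp Primrec.fst)
    refine primrecPred_exists_lt Primrec.fst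
      (primrecPred_exists_lt (Primrec.fst.comp Primrec.fst) (PrimrecPred.and
        (Primrec.eq.comp (Primrec.snd.comp Primrec.fst) Primrec.snd).not
        (primrecPred_forall_lt (Primrec.fst.comp (Primrec.fst.comp Primrec.fst)) ?_)))
    exact ((primrecPred_adjBit hn hs hu Primrec.snd).and
      (primrecPred_adjBit hn hs Primrec.snd (Primrec.snd.comp Primrec.fst))).not
  · simp only [adj_iff_adjBit_edgeString, Fin.exists_iff, Fin.forall_iff, exists_prop, ne_eq,
      Fin.mk.injEq]

theorem primrec_relayIndex_adjBit : Primrec fun a : ((ℕ × List Bool) × ℕ) × ℕ =>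
    relayIndex (adjBit a.1.1.1 a.1.1.2) (List.range a.1.1.1) a.1.2 a.2 := by
  have hn : Primrec fun a : ((ℕ × List Bool) × ℕ) × ℕ => a.1.1.1 :=
    Primrec.fst.comp (Primrec.fst.comp Primrec.fst)
  have hs : Primrec fun a : ((ℕ × List Bool) × ℕ) × ℕ => a.1.1.2 :=
    Primrec.snd.comp (Primrec.fst.comp Primrec.fst)
  have hw : Primrec fun a : ((ℕ × List Bool) × ℕ) × ℕ => a.1.2 := Primrec.snd.comp Primrec.fst
  have hfilter : Primrec fun a : ((ℕ × List Bool) × ℕ) × ℕ =>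
      (List.range a.1.1.1).filter (adjBit a.1.1.1 a.1.1.2 a.1.2) :=
    (PrimrecRel.listFilter (R := fun x (a : ((ℕ × List Bool) × ℕ) × ℕ) =>
      adjBit a.1.1.1 a.1.1.2 a.1.2 x = true) (primrecPred_adjBit (hn.comp Primrec.snd)
        (hs.comp Primrec.snd) (hw.comp Primrec.snd) Primrec.fst)).comp
      (Primrec.list_range.comp hn) Primrec.id |>.of_eq fun a => by simp
  exact Primrec.ite ((Primrec.eq.comp Primrec.snd hw).or (primrecPred_adjBit hn hs hw Primrec.snd))
    (Primrec.const 0) (Primrec.list_findIdx hfilter (primrec_adjBit (hn.comp Primrec.fst)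
      (hs.comp Primrec.fst) Primrec.snd (Primrec.snd.comp Primrec.fst)))

theorem sum_relayIndex_adjBit_edgeString {n : ℕ} (G : SimpleGraph (Fin n)) (w : Fin n) :
    ((List.range n).map fun v =>
        relayIndex (adjBit n (edgeString G)) (List.range n) w v + 1).sum =
      ((List.finRange n).map fun v => relayIndex (boolAdj G) (List.finRange n) w v + 1).sum := by
  rw [← List.map_coe_finRange_eq_range, List.map_map]
  simp only [Function.comp_def, relayIndex_map Fin.val_injective (adjBit_edgeString G)]

theorem isPrimrecGraphProperty_exists_lt_sum_relayIndex (k : ℕ) :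
    IsPrimrecGraphProperty fun n G => ∃ w : Fin n, 3 * n < k +
      ((List.finRange n).map fun v => relayIndex (boolAdj G) (List.finRange n) w v + 1).sum := by
  refine ⟨fun n s => ∃ w < n, 3 * n <
    k + ((List.range n).map fun v => relayIndex (adjBit n s) (List.range n) w v + 1).sum, ?_,
    fun n G => ?_⟩
  · have hn : Primrec fun a : (ℕ × List Bool) × ℕ => a.1.1 := Primrec.fst.comp Primrec.fst
    exact primrecPred_exists_lt Primrec.fst (Primrec.nat_lt.comp
      (Primrec.nat_mul.comp (Primrec.const 3) hn)
      (Primrec.nat_add.comp (Primrec.const k) (primrec_sum (Primrec.list_map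
        (Primrec.list_range.comp hn) (Primrec.succ.comp primrec_relayIndex_adjBit)))))
  · simp only [Fin.exists_iff, ← sum_relayIndex_adjBit_edgeString, exists_prop]

theorem graphProb_exists_forall_lt_not_adj_le (n m : ℕ) :
    graphProb (fun G : SimpleGraph (Fin n) =>
      ∃ u : Fin n, m ≤ u ∧ ∀ x : Fin n, (x : ℕ) < m → ¬ G.Adj x u) ≤ n * (1 / 2) ^ m := by
  convert graphProb_exists_le (fun u : Fin n => ?_) using 2
  · rw [Fintype.card_fin]
  by_cases hu : m ≤ u
  · have h := graphProb_forall_not_adj (S := Finset.univ.filter fun x : Fin n => (x : ℕ) < m)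
      (v := u) (by simpa using hu)
    rw [Fin.card_filter_val_lt, min_eq_right (hu.trans u.2.le)] at h
    simpa [hu] using h.le
  · simp [graphProb, hu]

theorem graphProb_exists_forall_not_adj_and_adj_le (n : ℕ) :
    graphProb (fun G : SimpleGraph (Fin n) =>
      ∃ u v : Fin n, u ≠ v ∧ ∀ x : Fin n, ¬ (G.Adj u x ∧ G.Adj x v)) ≤
      n ^ 2 * (16 / 9 * (3 / 4) ^ n) := by
  rw [sq, mul_assoc]
  convert graphProb_exists_le (fun u : Fin n => ?_) using 2
  · rw [Fintype.card_fin]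
  convert graphProb_exists_le (fun v : Fin n => ?_) using 2
  · rw [Fintype.card_fin]
  by_cases huv : u = v
  · simpa [graphProb, huv] using by positivity
  · have hcard : (Finset.univ \ {u, v} : Finset (Fin n)).card + 2 = n := by
      have := Finset.card_sdiff_add_card_eq_card (Finset.subset_univ {u, v})
      rwa [Finset.card_pair huv, Finset.card_univ, Fintype.card_fin] at this
    calc graphProb (fun G => u ≠ v ∧ ∀ x, ¬ (G.Adj u x ∧ G.Adj x v))
        ≤ graphProb fun G => ∀ x ∈ Finset.univ \ {u, v}, ¬ (G.Adj u x ∧ G.Adj x v) :=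
          graphProb_mono fun G hG x _ => hG.2 x
      _ = (3 / 4) ^ (Finset.univ \ {u, v} : Finset (Fin n)).card :=
          graphProb_forall_not_adj_and_adj huv (by simp) (by simp)
      _ = 16 / 9 * (3 / 4) ^ n := by
          conv_rhs => rw [← hcard, pow_add]
          ring

theorem graphProb_exists_lt_sum_relayIndex_le (k n : ℕ) :
    graphProb (fun G : SimpleGraph (Fin n) => ∃ w : Fin n, 3 * n < k +
      ((List.finRange n).map fun v => relayIndex (boolAdj G) (List.finRange n) w v + 1).sum) ≤
      n * ((4 / 3) ^ k * (27 / 32) ^ n) := by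
  convert graphProb_exists_le (fun w : Fin n => ?_) using 2
  · rw [Fintype.card_fin]
  calc _ ≤ graphProb fun G : SimpleGraph (Fin n) => 3 * n - k ≤
          ((List.finRange n).map fun v => relayIndex (boolAdj G) (List.finRange n) w v + 1).sum :=
        graphProb_mono fun G hG => by omega
    _ ≤ 2 ^ n * (3 / 4) ^ (3 * n - k) := by
        simpa using graphProb_le_sum_relayIndex_le (List.nodup_finRange n) w (3 * n - k)
    _ ≤ 2 ^ n * ((4 / 3) ^ k * (3 / 4) ^ (3 * n)) := by
        gcongr
        rw [show (4 / 3 : ℝ) = (3 / 4)⁻¹ by norm_num, inv_pow, ← div_eq_inv_mul,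
          le_div_iff₀ (by positivity), ← pow_add]
        exact pow_le_pow_of_le_one (by norm_num) (by norm_num) (by omega)
    _ = (4 / 3) ^ k * (27 / 32) ^ n := by
        rw [pow_mul, mul_left_comm, ← mul_pow]
        norm_num

theorem tendsto_rpow_mul_mul_two_div_pow {c : ℝ} {d : ℕ} (hd : c + 1 < d) :
    Tendsto (fun n : ℕ => (n : ℝ) ^ c * (n * (2 / n) ^ d)) atTop (𝓝 0) := by
  have h := ((tendsto_rpow_neg_atTop (sub_pos.2 hd)).comp
    tendsto_natCast_atTop_atTop).const_mul ((2 : ℝ) ^ d)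
  rw [mul_zero] at h
  refine h.congr' ?_
  filter_upwards [eventually_gt_atTop 0] with n hn
  have hn' : (0 : ℝ) < n := by exact_mod_cast hn
  rw [Function.comp_apply, neg_sub, Real.rpow_sub hn', Real.rpow_add_one hn'.ne',
    Real.rpow_natCast, div_pow]
  ring

theorem Machine.IsUniversal.eventually_exists_lt_adj {U : Machine} (hU : U.IsUniversal) {c : ℝ}
    {d : ℕ} (hd : c + 1 < d) :
    ∀ᶠ n : ℕ in atTop, ∀ {a : ℕ} {G : SimpleGraph (Fin n)},
      IsRandomGraph U a (c * Real.logb 2 n) G →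
      ∀ u : Fin n, d * Nat.log 2 n ≤ u → ∃ x : Fin n, (x : ℕ) < d * Nat.log 2 n ∧ G.Adj x u := by
  have hrare := hU.eventually_not_of_isRandomGraph
    (isPrimrecGraphProperty_exists_forall_lt_not_adj
      (Primrec.nat_mul.comp (Primrec.const d) primrec_log_two)) (c := c)
    (ε := fun n => n * (2 / n) ^ d) ?_ (tendsto_rpow_mul_mul_two_div_pow hd)
  · filter_upwards [hrare] with n hn a G hG
    simpa using hn hG
  · filter_upwards [eventually_gt_atTop 0] with n hn
    have hn' : (0 : ℝ) < n := by exact_mod_cast hn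
    refine (graphProb_exists_forall_lt_not_adj_le n _).trans ?_
    rw [mul_comm d, pow_mul]
    gcongr
    rw [one_div, inv_pow, inv_eq_one_div, div_le_div_iff₀ (by positivity) hn', one_mul, ← pow_succ']
    exact_mod_cast (Nat.lt_pow_succ_log_self one_lt_two n).le

theorem Machine.IsUniversal.eventually_exists_adj_and_adj {U : Machine} (hU : U.IsUniversal)
    (c : ℝ) :
    ∀ᶠ n : ℕ in atTop, ∀ {a : ℕ} {G : SimpleGraph (Fin n)},
      IsRandomGraph U a (c * Real.logb 2 n) G →
      ∀ u v : Fin n, u ≠ v → ∃ x, G.Adj u x ∧ G.Adj x v := by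
  filter_upwards [hU.eventually_not_of_isRandomGraph
    isPrimrecGraphProperty_exists_forall_not_adj_and_adj
    (Eventually.of_forall graphProb_exists_forall_not_adj_and_adj_le)
    (tendsto_rpow_mul_pow_mul_geometric c 2 (16 / 9) (by norm_num) (by norm_num))] with n hn a G hG
  simpa only [not_exists, not_and, not_forall, not_not, exists_prop] using hn hG

theorem Machine.IsUniversal.eventually_sum_relayIndex_le {U : Machine} (hU : U.IsUniversal)
    (c : ℝ) (k : ℕ) :
    ∀ᶠ n : ℕ in atTop, ∀ {a : ℕ} {G : SimpleGraph (Fin n)},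
      IsRandomGraph U a (c * Real.logb 2 n) G → ∀ w : Fin n, k +
        ((List.finRange n).map fun v => relayIndex (boolAdj G) (List.finRange n) w v + 1).sum ≤
          3 * n := by
  filter_upwards [hU.eventually_not_of_isRandomGraph
    (isPrimrecGraphProperty_exists_lt_sum_relayIndex k)
    (Eventually.of_forall (graphProb_exists_lt_sum_relayIndex_le k))
    (by simpa only [pow_one] using tendsto_rpow_mul_pow_mul_geometric c 1 ((4 / 3) ^ k)
          (r := 27 / 32) (by norm_num) (by norm_num))] with n hn a G hG
  simpa only [not_exists, not_lt] using hn hG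

/-! ### The local routing functions -/

/-- The prefix code `i ↦ 0^i 1`, applied to the members of a list. -/
def unaryCode (l : List ℕ) : List Bool := l.flatMap fun i => List.replicate i false ++ [true]

/-- The inverse of `unaryCode`. -/
def unaryDecode (p : List Bool) : List ℕ :=
  List.rec [] (fun b _ r => bif b then 0 :: r else (r.headI + 1) :: r.tail) p

theorem unaryDecode_unaryCode (l : List ℕ) : unaryDecode (unaryCode l) = l := by
  induction l with
  | nil => rfl
  | cons i l ih =>
    rw [unaryCode, List.flatMap_cons, ← unaryCode]
    induction i with
    | zero => exact congrArg (List.cons 0) ih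
    | succ i ihi =>
      rw [List.replicate_succ, List.cons_append, List.cons_append]
      change ((unaryDecode _).headI + 1) :: (unaryDecode _).tail = _
      rw [ihi]
      rfl

theorem length_unaryCode (l : List ℕ) : (unaryCode l).length = (l.map (· + 1)).sum := by
  simp [unaryCode, List.length_flatMap]

theorem primrec_unaryDecode : Primrec unaryDecode := by
  have hr : Primrec fun x : List Bool × Bool × List Bool × List ℕ => x.2.2.2 :=
    Primrec.snd.comp (Primrec.snd.comp Primrec.snd)
  have hstep : Primrec₂ fun (_ : List Bool) (x : Bool × List Bool × List ℕ) =>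
      bif x.1 then 0 :: x.2.2 else (x.2.2.headI + 1) :: x.2.2.tail :=
    Primrec.cond (Primrec.fst.comp Primrec.snd)
      (Primrec.list_cons.comp (Primrec.const 0) hr)
      (Primrec.list_cons.comp (Primrec.succ.comp (Primrec.list_headI.comp hr))
        (Primrec.list_tail.comp hr))
  exact Primrec.list_rec Primrec.id (Primrec.const []) hstep

/-- The label to which a node with the data `p` and the neighbours `nbrs` forwards a message for
`v`: directly if `v` is a neighbour, and otherwise to the neighbour whose place in `nbrs` the
unary code `p` contains for `v`. In particular the first neighbour is chosen if `p` is empty. -/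
def routeStep (p : List Bool) (nbrs : List ℕ) (v : ℕ) : ℕ :=
  if v ∈ nbrs then v else nbrs.getD ((unaryDecode p).getD (v - 1) 0) 0

/-- `routeStep` as a function of the input in the coding of `Forwards`. -/
def codedRouteStep (p : List Bool) (y : ℕ) : ℕ :=
  routeStep p (Denumerable.ofNat (ℕ × List ℕ × ℕ) y).2.1
    (Denumerable.ofNat (ℕ × List ℕ × ℕ) y).2.2

theorem codedRouteStep_encode (p : List Bool) (u : ℕ) (nbrs : List ℕ) (v : ℕ) :
    codedRouteStep p (Encodable.encode (u, nbrs, v)) = routeStep p nbrs v := by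
  rw [codedRouteStep, Denumerable.ofNat_encode]

theorem primrec_codedRouteStep : Primrec₂ codedRouteStep := by
  have hy : Primrec fun x : List Bool × ℕ => (Denumerable.ofNat (ℕ × List ℕ × ℕ) x.2).2 :=
    Primrec.snd.comp ((Primrec.ofNat (ℕ × List ℕ × ℕ)).comp Primrec.snd)
  have hnbrs := Primrec.fst.comp hy
  have hv := Primrec.snd.comp hy
  have hmem : PrimrecRel fun (v : ℕ) (nbrs : List ℕ) => v ∈ nbrs :=
    (Primrec.eq.exists_mem_list.comp Primrec.snd Primrec.fst).of_eq fun a => by simp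
  exact Primrec.ite (hmem.comp hv hnbrs) hv ((Primrec.list_getD 0).comp hnbrs
    ((Primrec.list_getD 0).comp (primrec_unaryDecode.comp Primrec.fst)
      (Primrec.nat_sub.comp hv (Primrec.const 1))))

section Scheme

variable {n : ℕ} {G : SimpleGraph (Fin n)}

/-- The data of a routing centre: in unary, its relays for the destinations `1, …, n`. -/
noncomputable def relayCode (G : SimpleGraph (Fin n)) (u : Fin n) : List Bool :=
  unaryCode ((List.finRange n).map (relayIndex (boolAdj G) (List.finRange n) u))

theorem length_relayCode (G : SimpleGraph (Fin n)) (u : Fin n) : (relayCode G u).length =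
    ((List.finRange n).map fun v => relayIndex (boolAdj G) (List.finRange n) u v + 1).sum := by
  rw [relayCode, length_unaryCode, List.map_map]
  rfl

theorem neighbourLabels_eq_map (G : SimpleGraph (Fin n)) (u : Fin n) :
    neighbourLabels G u = ((List.finRange n).filter (boolAdj G u)).map label := rfl

theorem label_injective : Function.Injective (label : Fin n → ℕ) := fun _ _ h =>
  Fin.ext (Nat.succ.inj h)

theorem label_mem_neighbourLabels {u v : Fin n} : label v ∈ neighbourLabels G u ↔ G.Adj u v := by
  rw [neighbourLabels_eq_map, List.mem_map_of_injective label_injective]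
  simp [boolAdj_eq_true]

theorem routeStep_of_adj {u v : Fin n} (p : List Bool) (h : G.Adj u v) :
    routeStep p (neighbourLabels G u) (label v) = label v :=
  if_pos (label_mem_neighbourLabels.2 h)

theorem routeStep_of_not_adj {u v : Fin n} (p : List Bool) (h : ¬ G.Adj u v) :
    routeStep p (neighbourLabels G u) (label v) =
      (neighbourLabels G u).getD ((unaryDecode p).getD v 0) 0 :=
  if_neg (mt label_mem_neighbourLabels.1 h)

theorem exists_le_routeStep_nil_eq {u v y : Fin n} (h : ¬ G.Adj u v) (hy : G.Adj u y) :
    ∃ w ≤ y, G.Adj u w ∧ routeStep [] (neighbourLabels G u) (label v) = label w := by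
  have hmem {x : Fin n} : x ∈ (List.finRange n).filter (boolAdj G u) ↔ G.Adj u x := by
    simp [boolAdj_eq_true]
  have hsort := (List.pairwise_lt_finRange n).filter (boolAdj G u)
  rw [routeStep_of_not_adj [] h, neighbourLabels_eq_map]
  rcases hL : (List.finRange n).filter (boolAdj G u) with _ | ⟨w, l⟩
  · simp [← hmem, hL] at hy
  · refine ⟨w, ?_, hmem.1 (by simp [hL]), rfl⟩
    rw [← hmem, hL, List.mem_cons] at hy
    rw [hL, List.pairwise_cons] at hsort
    exact hy.elim Eq.ge fun hyl => (hsort.1 y hyl).le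

theorem exists_routeStep_relayCode_eq {u v : Fin n} (huv : u ≠ v) (h : ¬ G.Adj u v)
    (hcommon : ∃ x, G.Adj u x ∧ G.Adj x v) :
    ∃ x, G.Adj u x ∧ G.Adj x v ∧
      routeStep (relayCode G u) (neighbourLabels G u) (label v) = label x := by
  set nbrs := (List.finRange n).filter (boolAdj G u) with hnbrs
  have hrelay : ((List.finRange n).map (relayIndex (boolAdj G) (List.finRange n) u)).getD v 0 =
      nbrs.findIdx fun x => boolAdj G x v := by
    rw [List.getD_eq_getElem _ _ (by simp), List.getElem_map, List.getElem_finRange]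
    exact if_neg (not_or.2 ⟨huv.symm, boolAdj_eq_true.not.2 h⟩)
  have hlt : (nbrs.findIdx fun x => boolAdj G x v) < nbrs.length := by
    simpa [List.findIdx_lt_length, hnbrs, boolAdj_eq_true] using hcommon
  refine ⟨nbrs[nbrs.findIdx fun x => boolAdj G x v],
    boolAdj_eq_true.1 (List.mem_filter.1 (List.getElem_mem hlt)).2,
    boolAdj_eq_true.1 (List.findIdx_getElem (w := hlt)), ?_⟩
  rw [routeStep_of_not_adj _ h, relayCode, unaryDecode_unaryCode, hrelay,
    neighbourLabels_eq_map, ← hnbrs, List.getD_eq_getElem _ _ (by simpa using hlt),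
    List.getElem_map]

/-- The data of the nodes when those below `m` are the routing centres. -/
noncomputable def relayTable (G : SimpleGraph (Fin n)) (m : ℕ) (u : Fin n) : List Bool :=
  if (u : ℕ) < m then relayCode G u else []

theorem relayTable_of_lt {m : ℕ} {u : Fin n} (hu : (u : ℕ) < m) :
    relayTable G m u = relayCode G u :=
  if_pos hu

theorem relayTable_of_le {m : ℕ} {u : Fin n} (hu : m ≤ u) : relayTable G m u = [] :=
  if_neg hu.not_gt

variable {R : Machine} {F : Fin n → List Bool} {m : ℕ}

theorem forwards_of_routeStep_eq {p : List Bool} {u v w : Fin n}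
    (hF : ∀ y, R (F u) y = Part.some (codedRouteStep p y)) (huw : G.Adj u w)
    (h : routeStep p (neighbourLabels G u) (label v) = label w) : Forwards R G F v u w :=
  ⟨huw, by rw [hF, codedRouteStep_encode, h]; exact Part.mem_some _⟩

theorem route_one_of_adj {p : List Bool} {u v : Fin n}
    (hF : ∀ y, R (F u) y = Part.some (codedRouteStep p y)) (h : G.Adj u v) :
    Route R G F v u 1 :=
  .step h.ne (forwards_of_routeStep_eq hF h (routeStep_of_adj _ h)) .arrive

theorem route_two_of_lt {u v : Fin n}
    (hF : ∀ u y, R (F u) y = Part.some (codedRouteStep (relayTable G m u) y)) (hu : (u : ℕ) < m)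
    (huv : u ≠ v) (h : ¬ G.Adj u v) (hcommon : ∃ x, G.Adj u x ∧ G.Adj x v) :
    Route R G F v u 2 := by
  obtain ⟨x, hux, hxv, hstep⟩ := exists_routeStep_relayCode_eq huv h hcommon
  exact .step huv (forwards_of_routeStep_eq (hF u) hux (by rwa [relayTable_of_lt hu]))
    (route_one_of_adj (hF x) hxv)

theorem exists_route_le_three {u v : Fin n}
    (hF : ∀ u y, R (F u) y = Part.some (codedRouteStep (relayTable G m u) y))
    (hcentre : m ≤ u → ∃ x : Fin n, (x : ℕ) < m ∧ G.Adj x u)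
    (hcommon : ∀ w, w ≠ v → ∃ x, G.Adj w x ∧ G.Adj x v) (huv : u ≠ v) (h : ¬ G.Adj u v) :
    ∃ k ≤ 3, Route R G F v u k := by
  rcases lt_or_ge (u : ℕ) m with hu | hu
  · exact ⟨2, by norm_num, route_two_of_lt hF hu huv h (hcommon u huv)⟩
  obtain ⟨y, hym, hyu⟩ := hcentre hu
  obtain ⟨w, hwy, huw, hstep⟩ := exists_le_routeStep_nil_eq h hyu.symm
  have hfwd : Forwards R G F v u w :=
    forwards_of_routeStep_eq (hF u) huw (by rwa [relayTable_of_le hu])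
  have hwv : w ≠ v := by
    rintro rfl
    exact h huw
  by_cases hadj : G.Adj w v
  · exact ⟨2, by norm_num, .step huv hfwd (route_one_of_adj (hF w) hadj)⟩
  · exact ⟨3, le_rfl, .step huv hfwd
      (route_two_of_lt hF (lt_of_le_of_lt hwy hym) hwv hadj (hcommon w hwv))⟩

theorem hasStretchAtMost_relayTable
    (hF : ∀ u y, R (F u) y = Part.some (codedRouteStep (relayTable G m u) y))
    (hcentre : ∀ u : Fin n, m ≤ u → ∃ x : Fin n, (x : ℕ) < m ∧ G.Adj x u)
    (hcommon : ∀ u v : Fin n, u ≠ v → ∃ x, G.Adj u x ∧ G.Adj x v) :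
    HasStretchAtMost R G F (3 / 2) := by
  intro u v huv
  by_cases h : G.Adj u v
  · refine ⟨1, route_one_of_adj (hF u) h, ?_⟩
    rw [SimpleGraph.dist_eq_one_iff_adj.2 h]
    norm_num
  obtain ⟨k, hk, hroute⟩ := exists_route_le_three hF (hcentre u) (hcommon · v) huv h
  refine ⟨k, hroute, ?_⟩
  obtain ⟨x, hux, hxv⟩ := hcommon u v huv
  have hpos : 0 < G.dist u v := (hux.reachable.trans hxv.reachable).pos_dist_of_ne huv
  have hne : G.dist u v ≠ 1 := mt SimpleGraph.dist_eq_one_iff_adj.1 h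
  have hdist : (2 : ℝ) ≤ G.dist u v := by exact_mod_cast (show 2 ≤ G.dist u v by omega)
  have hk' : (k : ℝ) ≤ 3 := by exact_mod_cast hk
  linarith

end Scheme

/-! ### The size of the routing scheme -/

theorem card_filter_val_lt_mul_log_le {d : ℕ} {x : ℝ} (hd : d ≤ x) (n : ℕ) :
    ((Finset.univ.filter fun u : Fin n => (u : ℕ) < d * Nat.log 2 n).card : ℝ) ≤
      x * Real.logb 2 n := by
  calc ((Finset.univ.filter fun u : Fin n => (u : ℕ) < d * Nat.log 2 n).card : ℝ)
      ≤ (d * Nat.log 2 n : ℕ) := by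
        rw [Fin.card_filter_val_lt]
        exact_mod_cast min_le_right _ _
    _ = d * Nat.log 2 n := Nat.cast_mul _ _
    _ ≤ x * Real.logb 2 n :=
        mul_le_mul hd (by exact_mod_cast Real.natLog_le_logb n 2) (Nat.cast_nonneg _)
          ((Nat.cast_nonneg d).trans hd)

theorem pos_of_lt_logb {k n : ℕ} (hk : k < Real.logb 2 n) : 0 < n := by
  refine Nat.pos_of_ne_zero fun hn => ?_
  rw [hn, Nat.cast_zero, Real.logb_zero] at hk
  exact (Nat.cast_nonneg k).not_gt hk

theorem le_ceil_logb_add_one {k n : ℕ} (hk : k < Real.logb 2 n) :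
    k ≤ ⌈Real.logb 2 ((n : ℝ) + 1)⌉₊ := by
  have hmono : Real.logb 2 n ≤ Real.logb 2 ((n : ℝ) + 1) :=
    Real.logb_le_logb_of_le one_lt_two (Nat.cast_pos.2 (pos_of_lt_logb hk)) (by linarith)
  exact_mod_cast (hk.le.trans hmono).trans (Nat.le_ceil _)

theorem sum_le_card_mul_add_card_mul {ι : Type*} [Fintype ι] {f : ι → ℕ} {B : Finset ι} {a b : ℕ}
    (hB : ∀ i ∈ B, f i ≤ a) (hBc : ∀ i ∉ B, f i ≤ b) :
    ∑ i, f i ≤ B.card * a + Fintype.card ι * b := by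
  classical
  rw [← Finset.sum_add_sum_compl B]
  refine add_le_add (Finset.sum_le_card_nsmul _ _ _ hB) ?_
  calc ∑ i ∈ Bᶜ, f i ≤ Bᶜ.card * b :=
        Finset.sum_le_card_nsmul _ _ _ fun i hi => hBc i (Finset.mem_compl.1 hi)
    _ ≤ Fintype.card ι * b := Nat.mul_le_mul_right _ (Finset.card_le_univ _)

theorem sum_lt_of_le_three_mul {n k : ℕ} {f : Fin n → ℕ} {B : Finset (Fin n)} {c : ℝ}
    (hcard : B.card ≤ (c + 3) * Real.logb 2 n) (hk : k < Real.logb 2 n)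
    (hB : ∀ u ∈ B, f u ≤ 3 * n) (hBc : ∀ u ∉ B, f u ≤ k) :
    ∑ u, (f u : ℝ) < (3 * c + 20) * n * Real.logb 2 n := by
  have hsum : ∑ u, (f u : ℝ) ≤ B.card * (3 * n) + n * k := by
    exact_mod_cast (sum_le_card_mul_add_card_mul hB hBc).trans_eq (by rw [Fintype.card_fin])
  have hpos : 0 < (n : ℝ) * Real.logb 2 n :=
    mul_pos (Nat.cast_pos.2 (pos_of_lt_logb hk)) ((Nat.cast_nonneg k).trans_lt hk)
  calc ∑ u, (f u : ℝ) ≤ B.card * (3 * n) + n * k := hsum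
    _ ≤ (c + 3) * Real.logb 2 n * (3 * n) + n * Real.logb 2 n := by gcongr
    _ < (3 * c + 20) * n * Real.logb 2 n := by linarith

end CompactRouting

theorem mainTheorem10 (U R : CompactRouting.Machine) (hU : U.IsUniversal) (hR : R.IsUniversal)
    (c : ℝ) (hc : 0 ≤ c) :
    ∃ n₀ : ℕ, ∀ n : ℕ, n₀ ≤ n → ∀ (a : ℕ) (G : SimpleGraph (Fin n)),
      CompactRouting.IsRandomGraph U a (c * Real.logb 2 (n : ℝ)) G →
        ∃ (F : Fin n → List Bool) (B : Finset (Fin n)),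
          CompactRouting.HasStretchAtMost R G F (3 / 2) ∧
          (B.card : ℝ) ≤ 1 + (c + 3) * Real.logb 2 (n : ℝ) ∧
          (∀ u : Fin n, u ∉ B → (F u).length ≤ ⌈Real.logb 2 ((n : ℝ) + 1)⌉₊) ∧
          (∀ u : Fin n, u ∈ B → (F u).length ≤ 3 * n) ∧
          (∑ u : Fin n, ((F u).length : ℝ)) < (3 * c + 20) * (n : ℝ) * Real.logb 2 (n : ℝ) := by
  open CompactRouting Filter in
  obtain ⟨k, hk⟩ := hR.exists_program primrec_codedRouteStep.to_comp
  choose F hF_length hF using hk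
  obtain ⟨d, hcd, hdc⟩ : ∃ d : ℕ, c + 1 < d ∧ d ≤ c + 3 :=
    ⟨⌊c⌋₊ + 2, by push_cast; linarith [Nat.lt_floor_add_one c],
      by push_cast; linarith [Nat.floor_le hc]⟩
  refine eventually_atTop.1 ?_
  filter_upwards [hU.eventually_exists_lt_adj hcd, hU.eventually_exists_adj_and_adj c,
    hU.eventually_sum_relayIndex_le c k, ((Real.tendsto_logb_atTop one_lt_two).comp
      tendsto_natCast_atTop_atTop).eventually_gt_atTop (k : ℝ)]
    with n hcentre hcommon hsum hlog a G hG
  let B : Finset (Fin n) := Finset.univ.filter fun u => (u : ℕ) < d * Nat.log 2 n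
  have hcard : (B.card : ℝ) ≤ (c + 3) * Real.logb 2 n := card_filter_val_lt_mul_log_le hdc n
  have hB (u : Fin n) (hu : u ∈ B) : (F (relayTable G (d * Nat.log 2 n) u)).length ≤ 3 * n := by
    rw [relayTable_of_lt (Finset.mem_filter.1 hu).2]
    exact (hF_length _).trans (by rw [length_relayCode, add_comm]; exact hsum hG u)
  have hBc (u : Fin n) (hu : u ∉ B) : (F (relayTable G (d * Nat.log 2 n) u)).length ≤ k := by
    rw [relayTable_of_le (by simpa [B] using hu)]
    simpa using hF_length []
  exact ⟨fun u => F (relayTable G (d * Nat.log 2 n) u), B,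
    hasStretchAtMost_relayTable (fun u => hF _) (hcentre hG) (hcommon hG), by linarith,
    fun u hu => (hBc u hu).trans (le_ceil_logb_add_one hlog), hB,
    sum_lt_of_le_three_mul hcard hlog hB hBc⟩
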